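/- Let $k\ge 2$ be an integer and let $p$ be an odd prime. Let $$F(t)={}_{k-1}F_{k-2}\left(\tfrac12,\ldots,\tfrac12;1,\ldots,1\,\middle|\,t\right)=\sum_{l\ge 0}\frac{(1/2)_l^{\,k-1}}{(1)_l^{\,k-2}\,l!}\,t^l=\sum_{l\ge 0}\left(\frac{(1/2)_l}{l!}\right)^{k-1}t^l$$ be the hypergeometric series with $k-1$ upper parameters equal to $\tfrac12$ and $k-2$ lower parameters equal to $1$, where $(x)_l=x(x+1)\cdots(x+l-1)$. Then $F(t)$ has coefficients in $\mathbb Z_p$ and constant term $1$, and for every integer $s\ge 1$ the Dwork congruence $$\frac{F(t)}{F(t^p)}\equiv\frac{F_{p^s}(t)}{F_{p^{s-1}}(t^p)}\pmod{p^s}$$ holds in $\mathbb Z_p[[t]]$. Here $F_m(t)$ denotes the polynomial obtained from $F(t)$ by deleting all terms of degree $\ge m$, and $F_{p^{s-1}}(t^p)$ is the result of substituting $t^p$ for $t$ in $F_{p^{s-1}}(t)$. (The case $k=3$ is Dwork's example ${}_2F_1(\tfrac12,\tfrac12;1\,|\,t)$.) -/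

import Mathlib

open PowerSeries

/-- The generalized hypergeometric series
`∑ₙ (∏ᵢ (aᵢ)ₙ) / (∏ⱼ (bⱼ)ₙ) * tⁿ / n!` with upper parameters `a` and lower parameters `b`,
as a formal power series over a field `K`; here `(x)ₙ = x (x + 1) ⋯ (x + n - 1)`.
(No `bⱼ` should be a nonpositive integer.) -/
noncomputable def hypergeometricSeries {K : Type*} [Field K] {q r : ℕ}
    (a : Fin q → K) (b : Fin r → K) : K⟦X⟧ :=
  PowerSeries.mk fun n =>
    (∏ i, (ascPochhammer K n).eval (a i)) /
      ((∏ j, (ascPochhammer K n).eval (b j)) * (n.factorial : K))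

/-- The truncation `F(t)_m`: all terms of degree `≥ m` are deleted. -/
noncomputable def truncSeries {R : Type*} [CommRing R] (m : ℕ) (F : R⟦X⟧) : R⟦X⟧ :=
  (PowerSeries.trunc m F : Polynomial R)

/-- The substitution `F(t) ↦ F(t^p)`. -/
noncomputable def frobSubst (p : ℕ) [hp : Fact p.Prime] {R : Type*} [CommRing R]
    (F : R⟦X⟧) : R⟦X⟧ :=
  PowerSeries.expand p hp.out.ne_zero F

/-- The quotient `G / H` of power series, for `H` with constant term `1`. -/
noncomputable def seriesQuot {R : Type*} [CommRing R] (G H : R⟦X⟧) : R⟦X⟧ :=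
  G * PowerSeries.invOfUnit H 1

/-- `seriesQuot G H` is the unique power series whose product with `H` is `G`. -/
theorem seriesQuot_eq_iff {R : Type*} [CommRing R] (G H Q : R⟦X⟧)
    (hH : constantCoeff H = 1) : seriesQuot G H = Q ↔ G = Q * H := by
  have h : H * PowerSeries.invOfUnit H 1 = 1 := PowerSeries.mul_invOfUnit H 1 (by simpa using hH)
  unfold seriesQuot
  constructor
  · rintro rfl
    rw [mul_assoc, mul_comm _ H, h, mul_one]
  · rintro rfl
    rw [mul_assoc, h, mul_one]

/-- The Dwork congruence at level `s`, for `F` with coefficients in `ℤ_p` and constant term `1`: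
`F(t) / F(t^p) ≡ F_{p^s}(t) / F_{p^{s-1}}(t^p)  (mod p^s)` in `ℤ_p⟦t⟧`.
The denominator on the right is the truncation of `F` below degree `p^{s-1}`, evaluated at `t^p`. -/
def DworkCongruence (p : ℕ) [Fact p.Prime] (F : ℤ_[p]⟦X⟧) (s : ℕ) : Prop :=
  (p : ℤ_[p]⟦X⟧) ^ s ∣
    seriesQuot F (frobSubst p F) -
      seriesQuot (truncSeries (p ^ s) F) (frobSubst p (truncSeries (p ^ (s - 1)) F))

/-! Let `A n` be the coefficients and `ρ n` the ratio of `A n` to `A ⌊n/p⌋`. Dwork's argument needs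
only that `ρ` is integral and `ρ (n + m p^(s+1)) ≡ ρ n` mod `p^(s+1)`. After clearing the unit
denominators, the coefficient of `t^(a + pN)` in the congruence is a sum over `j < p^s` of the terms
`A j` times the defect at `j`. Over all `j ≤ N` such a sum vanishes by symmetry; that each block of
length `p^s` is already divisible by `p^(s+1)` is `dvd_dworkBlock`, by induction on `s`. For
`(1/2)_n / n!` the ratio compares the prime-to-`p` parts of `1·3⋯(2n-1)` and `2·4⋯(2n)`. Lengthening
both by `p^(s+1)` factors multiplies each by the product of all units mod `p^(s+1)`, which cancels
(`toZModPow_halfRatio_add_pow`). Powers inherit both properties. -/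

/-! ### Dwork's block sums for an abstract sequence -/

section DworkCombinatorics

variable {R : Type*} [CommRing R]

/-- The defect `A(a + p(N - j)) - A(N - j) ρ(a + p j)` for `j ≤ N`, extended by zero. -/
def dworkDefect (A ρ : ℕ → R) (p a N j : ℕ) : R :=
  if j ≤ N then A (a + p * (N - j)) - A (N - j) * ρ (a + p * j) else 0

/-- `s`-fold application of the operator `f ↦ (i ↦ ∑_{u < p} ρ(u + p i) f(u + p i))` to the
defect. Up to the factor `A i`, this is the sum of `A j` times the defect at `j` over the block
`i p ^ s ≤ j < (i + 1) p ^ s`. -/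
def dworkBlock (A ρ : ℕ → R) (p a : ℕ) : ℕ → ℕ → ℕ → R
  | 0, N, i => dworkDefect A ρ p a N i
  | s + 1, N, i =>
    ∑ u ∈ Finset.range p, ρ (u + p * i) * dworkBlock A ρ p a s N (u + p * i)

theorem sum_range_mul_eq_sum_sum {M : Type*} [AddCommMonoid M] (p m : ℕ) (f : ℕ → M) :
    ∑ i ∈ Finset.range (p * m), f i =
      ∑ i ∈ Finset.range m, ∑ u ∈ Finset.range p, f (u + p * i) := by
  induction m with
  | zero => simp
  | succ m ih =>
    rw [Nat.mul_succ, Finset.sum_range_add, ih, Finset.sum_range_succ]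
    simp only [add_comm]

variable {A ρ : ℕ → R} {p : ℕ}

theorem sum_mul_dworkDefect_eq_sum_mul_dworkBlock (hp : 0 < p)
    (hA : ∀ n, A n = A (n / p) * ρ n) (a s N m : ℕ) :
    ∑ j ∈ Finset.range (p ^ s * m), A j * dworkDefect A ρ p a N j =
      ∑ i ∈ Finset.range m, A i * dworkBlock A ρ p a s N i := by
  induction s generalizing m with
  | zero => simp [dworkBlock]
  | succ s ih =>
    rw [pow_succ, mul_assoc, ih, sum_range_mul_eq_sum_sum]
    refine Finset.sum_congr rfl fun i _ => ?_
    rw [dworkBlock, Finset.mul_sum]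
    refine Finset.sum_congr rfl fun u hu => ?_
    rw [hA (u + p * i), Nat.add_mul_div_left _ _ hp,
      Nat.div_eq_of_lt (Finset.mem_range.1 hu), zero_add, mul_assoc]

/-- Since `A j * ρ (a + p * j) = A (a + p * j)`, the summand is antisymmetric under `j ↔ N - j`. -/
theorem sum_mul_dworkDefect_eq_zero (hp : 0 < p) (hA : ∀ n, A n = A (n / p) * ρ n)
    {a : ℕ} (ha : a < p) (N : ℕ) :
    ∑ j ∈ Finset.range (N + 1), A j * dworkDefect A ρ p a N j = 0 := by
  have h : ∀ j ∈ Finset.range (N + 1), A j * dworkDefect A ρ p a N j =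
      A j * A (a + p * (N - j)) - A (N - j) * A (a + p * j) := by
    intro j hj
    have hj' : j ≤ N := Nat.lt_succ_iff.1 (Finset.mem_range.1 hj)
    have := hA (a + p * j)
    rw [Nat.add_mul_div_left _ _ hp, Nat.div_eq_of_lt ha, zero_add] at this
    rw [dworkDefect, if_pos hj', this]
    ring
  rw [Finset.sum_congr rfl h, Finset.sum_sub_distrib, sub_eq_zero,
    ← Finset.sum_range_reflect (fun j => A (N - j) * A (a + p * j))]
  refine Finset.sum_congr rfl fun j hj => ?_
  have hj' : j ≤ N := Nat.lt_succ_iff.1 (Finset.mem_range.1 hj)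
  rw [show N + 1 - 1 - j = N - j by omega, Nat.sub_sub_self hj']

theorem dworkBlock_eq_zero (a s : ℕ) {N i : ℕ} (h : N < p ^ s * i) :
    dworkBlock A ρ p a s N i = 0 := by
  induction s generalizing i with
  | zero =>
    rw [dworkBlock, dworkDefect, if_neg]
    simpa using h
  | succ s ih =>
    rw [dworkBlock]
    refine Finset.sum_eq_zero fun u _ => ?_
    rw [ih, mul_zero]
    calc N < p ^ (s + 1) * i := h
      _ = p ^ s * (p * i) := by ring
      _ ≤ p ^ s * (u + p * i) := Nat.mul_le_mul_left _ (Nat.le_add_left _ _)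

/-- Shifting `N` and the index together fixes `N - j`, so only arguments of `ρ` move. At each level
the change in `ρ` gives `p^(r+1)` and the lower block, by `ih`, supplies the missing power of `p`.
-/
theorem dvd_dworkBlock_shift_sub (hρ : ∀ s n m, (p : R) ^ (s + 1) ∣ ρ (n + m * p ^ (s + 1)) - ρ n)
    (a s N m : ℕ)
    (ih : ∀ u < s, ∀ N i, (p : R) ^ (u + 1) ∣ dworkBlock A ρ p a u N i) (t r i : ℕ)
    (htr : t + r = s) :
    (p : R) ^ (s + 1) ∣
      dworkBlock A ρ p a t (N + m * p ^ s) (i + m * p ^ r) - dworkBlock A ρ p a t N i := by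
  induction t generalizing r i with
  | zero =>
    obtain rfl : r = s := by omega
    rw [dworkBlock, dworkBlock, dworkDefect, dworkDefect]
    by_cases h : i ≤ N
    · rw [if_pos (Nat.add_le_add_right h _), if_pos h, Nat.add_sub_add_right,
        show a + p * (i + m * p ^ r) = a + p * i + m * p ^ (r + 1) by ring]
      refine (Dvd.dvd.mul_left (hρ r (a + p * i) m) (-A (N - i))).trans (dvd_of_eq ?_)
      ring
    · rw [if_neg (by simpa using h), if_neg h, sub_zero]
      exact dvd_zero _
  | succ t iht =>
    rw [dworkBlock, dworkBlock, ← Finset.sum_sub_distrib]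
    refine Finset.dvd_sum fun u _ => ?_
    have h1 := iht (r + 1) (u + p * i) (by omega)
    have h2 := mul_dvd_mul (hρ r (u + p * i) m) (ih t (by omega) N (u + p * i))
    rw [← pow_add, show r + 1 + (t + 1) = s + 1 by omega] at h2
    rw [show u + p * (i + m * p ^ r) = u + p * i + m * p ^ (r + 1) by ring]
    refine (dvd_add (h1.mul_left (ρ (u + p * i + m * p ^ (r + 1)))) h2).trans (dvd_of_eq ?_)
    ring

/-- Dwork's divisibility of the block sums. -/
theorem dvd_dworkBlock (hp : 0 < p) (h0 : A 0 = 1) (hA : ∀ n, A n = A (n / p) * ρ n)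
    (hρ : ∀ s n m, (p : R) ^ (s + 1) ∣ ρ (n + m * p ^ (s + 1)) - ρ n)
    {a : ℕ} (ha : a < p) (s N i : ℕ) :
    (p : R) ^ (s + 1) ∣ dworkBlock A ρ p a s N i := by
  induction s using Nat.strong_induction_on generalizing N i with
  | _ s ih =>
    rcases Nat.eq_zero_or_pos s with rfl | hs
    · rw [dworkBlock, dworkDefect]
      split_ifs with h
      · have hn := hA (a + p * (N - i))
        rw [Nat.add_mul_div_left _ _ hp, Nat.div_eq_of_lt ha, zero_add] at hn
        have h1 := hρ 0 a (N - i)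
        have h2 := hρ 0 a i
        rw [zero_add, pow_one, pow_one] at h1 h2
        rw [hn, zero_add, pow_one, mul_comm p, mul_comm p]
        refine ((dvd_sub h1 h2).mul_left (A (N - i))).trans (dvd_of_eq ?_)
        ring
      · exact dvd_zero _
    · have shift : ∀ N m, (p : R) ^ (s + 1) ∣
          dworkBlock A ρ p a s (N + m * p ^ s) m - dworkBlock A ρ p a s N 0 := by
        intro N m
        simpa using dvd_dworkBlock_shift_sub hρ a s N m ih s 0 0 rfl
      have base : ∀ N, (p : R) ^ (s + 1) ∣ dworkBlock A ρ p a s N 0 := by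
        intro N
        induction N using Nat.strong_induction_on with
        | _ N ihN =>
          -- The blocks sum to zero, so block `0` is minus the sum of the later ones. Each of these
          -- vanishes or is congruent to block `0` for a smaller `N`.
          have hsum := sum_mul_dworkDefect_eq_sum_mul_dworkBlock hp hA a s N (N + 1)
          rw [← Finset.sum_subset (Finset.range_subset_range.2
              (Nat.le_mul_of_pos_left (N + 1) (pow_pos hp s))),
            sum_mul_dworkDefect_eq_zero hp hA ha, Finset.sum_range_succ', h0, one_mul] at hsum
          · rw [← neg_eq_of_add_eq_zero_right hsum.symm, dvd_neg]
            refine Finset.dvd_sum fun m _ => Dvd.dvd.mul_left ?_ _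
            rcases le_or_gt (p ^ s * (m + 1)) N with h | h
            · obtain ⟨N', rfl⟩ := Nat.exists_eq_add_of_le' h
              rw [mul_comm]
              rw [← dvd_sub_left (ihN N' _)]
              · exact shift N' (m + 1)
              · exact Nat.lt_add_of_pos_right (Nat.mul_pos (pow_pos hp s) m.succ_pos)
            · rw [dworkBlock_eq_zero a s h]
              exact dvd_zero _
          · intro j _ hj
            rw [dworkDefect, if_neg (by simpa using hj), mul_zero]
      rcases le_or_gt (p ^ s * i) N with h | h
      · obtain ⟨N', rfl⟩ := Nat.exists_eq_add_of_le' h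
        rw [mul_comm, ← dvd_sub_left (base N')]
        exact shift N' i
      · rw [dworkBlock_eq_zero a s h]
        exact dvd_zero _

end DworkCombinatorics

/-! ### From block sums to the congruence of power series -/

section DworkCongruenceOfSequence

theorem coeff_mul_expand {R : Type*} [CommRing R] {p : ℕ} (hp : p ≠ 0) (F G : R⟦X⟧) {a : ℕ}
    (ha : a < p) (N : ℕ) :
    coeff (a + p * N) (F * PowerSeries.expand p hp G) =
      ∑ j ∈ Finset.range (N + 1), coeff (a + p * (N - j)) F * coeff j G := by
  rw [mul_comm F, coeff_mul, Finset.Nat.sum_antidiagonal_eq_sum_range_succ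
    (fun i j => coeff i (PowerSeries.expand p hp G) * coeff j F)]
  symm
  refine Finset.sum_of_injOn (fun j => p * j)
    (fun x _ y _ h => Nat.eq_of_mul_eq_mul_left (Nat.pos_of_ne_zero hp) h) ?_ ?_ ?_
  · intro j hj
    simp only [Finset.coe_range, Set.mem_Iio] at hj ⊢
    have := Nat.mul_le_mul_left p (Nat.lt_succ_iff.1 hj)
    omega
  · intro i hi hi'
    rw [coeff_expand, if_neg, zero_mul]
    rintro ⟨j, rfl⟩
    refine hi' ⟨j, ?_, rfl⟩
    simp only [Finset.coe_range, Set.mem_Iio, Finset.mem_range] at hi ⊢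
    by_contra h
    have := Nat.mul_le_mul_left p (not_lt.1 h)
    rw [Nat.mul_succ] at this
    omega
  · intro j hj
    have := Nat.mul_le_mul_left p (Nat.lt_succ_iff.1 (Finset.mem_range.1 hj))
    rw [coeff_expand_mul, mul_comm, Nat.add_sub_assoc this, ← Nat.mul_sub]

theorem coeff_truncSeries {R : Type*} [CommRing R] (m n : ℕ) (F : R⟦X⟧) :
    coeff n (truncSeries m F) = if n < m then coeff n F else 0 := by
  rw [truncSeries, Polynomial.coeff_coe, coeff_trunc]

theorem natCast_pow_dvd_powerSeries {R : Type*} [CommRing R] {p s : ℕ} {F : R⟦X⟧}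
    (h : ∀ n, (p : R) ^ s ∣ coeff n F) : (p : R⟦X⟧) ^ s ∣ F := by
  choose g hg using h
  refine ⟨PowerSeries.mk g, ?_⟩
  ext n
  rw [hg, show (p : R⟦X⟧) ^ s = C ((p : R) ^ s) by simp, coeff_C_mul, coeff_mk]

theorem dwork_congruence_mul {R : Type*} [CommRing R] {A ρ : ℕ → R} {p : ℕ} [hp : Fact p.Prime]
    (h0 : A 0 = 1) (hA : ∀ n, A n = A (n / p) * ρ n)
    (hρ : ∀ s n m, (p : R) ^ (s + 1) ∣ ρ (n + m * p ^ (s + 1)) - ρ n) (s : ℕ) :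
    (p : R⟦X⟧) ^ (s + 1) ∣ mk A * frobSubst p (truncSeries (p ^ s) (mk A)) -
      truncSeries (p ^ (s + 1)) (mk A) * frobSubst p (mk A) := by
  refine natCast_pow_dvd_powerSeries fun n => ?_
  have hp0 := hp.out.pos
  obtain ⟨a, N, ha, rfl⟩ : ∃ a N, a < p ∧ n = a + p * N :=
    ⟨n % p, n / p, Nat.mod_lt _ hp0, (Nat.mod_add_div n p).symm⟩
  rw [map_sub, frobSubst, frobSubst, coeff_mul_expand _ _ _ ha, coeff_mul_expand _ _ _ ha,
    ← Finset.sum_range_reflect (fun j => coeff (a + p * (N - j)) (truncSeries _ (mk A)) * _),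
    ← Finset.sum_sub_distrib]
  have hsum := sum_mul_dworkDefect_eq_sum_mul_dworkBlock hp0 hA a s N 1
  rw [Finset.sum_range_one, h0, one_mul, mul_one] at hsum
  refine (dvd_dworkBlock hp0 h0 hA hρ ha s N 0).trans (dvd_of_eq ?_)
  rw [← hsum, ← Finset.sum_subset (Finset.filter_subset (· ≤ N) _)]
  · rw [← Finset.sum_subset (Finset.filter_subset (· < p ^ s) (Finset.range (N + 1)))]
    · refine Finset.sum_congr (by ext; simp [and_comm]) fun j hj => ?_
      simp only [Finset.mem_filter, Finset.mem_range, Nat.lt_succ_iff] at hj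
      have hlt : a + p * j < p ^ (s + 1) := by
        have := Nat.mul_le_mul_left p (Nat.succ_le_of_lt hj.2)
        rw [Nat.mul_succ, ← pow_succ'] at this
        omega
      have hAj := hA (a + p * j)
      rw [Nat.add_mul_div_left _ _ hp0, Nat.div_eq_of_lt ha, zero_add] at hAj
      rw [show N + 1 - 1 - j = N - j by omega, Nat.sub_sub_self hj.1]
      simp only [coeff_truncSeries, coeff_mk, if_pos hlt, if_pos hj.2, dworkDefect, if_pos hj.1,
        hAj]
      ring
    -- For `j ≥ p^s` both products vanish, since `a + p * j ≥ p^(s+1)` as well.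
    · intro j hj hj'
      simp only [Finset.mem_filter, Finset.mem_range, Nat.lt_succ_iff, not_and, not_lt]
        at hj hj'
      have hge : ¬ a + p * j < p ^ (s + 1) := by
        have := Nat.mul_le_mul_left p (hj' hj)
        rw [← pow_succ'] at this
        omega
      rw [show N + 1 - 1 - j = N - j by omega, Nat.sub_sub_self hj]
      simp only [coeff_truncSeries, if_neg hge, if_neg (not_lt.2 (hj' hj))]
      ring
  · intro j hj hj'
    simp only [Finset.mem_filter, hj, true_and] at hj'
    rw [dworkDefect, if_neg hj', mul_zero]

theorem dworkCongruence_mk {p : ℕ} [hp : Fact p.Prime] {A ρ : ℕ → ℤ_[p]}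
    (h0 : A 0 = 1) (hA : ∀ n, A n = A (n / p) * ρ n)
    (hρ : ∀ s n m, (p : ℤ_[p]) ^ (s + 1) ∣ ρ (n + m * p ^ (s + 1)) - ρ n)
    {s : ℕ} (hs : 1 ≤ s) : DworkCongruence p (mk A) s := by
  obtain ⟨s, rfl⟩ := Nat.exists_eq_add_of_le' hs
  rw [DworkCongruence, Nat.add_sub_cancel]
  have hG : constantCoeff (frobSubst p (mk A)) = 1 := by
    rw [← coeff_zero_eq_constantCoeff_apply, frobSubst, coeff_expand]
    simp [h0]
  have hS : constantCoeff (frobSubst p (truncSeries (p ^ s) (mk A))) = 1 := by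
    rw [← coeff_zero_eq_constantCoeff_apply, frobSubst, coeff_expand]
    simp [coeff_truncSeries, h0, hp.out.pos]
  have h1 := (seriesQuot_eq_iff (mk A) _ _ hG).1 rfl
  have h2 := (seriesQuot_eq_iff (truncSeries (p ^ (s + 1)) (mk A)) _ _ hS).1 rfl
  have hdvd := dwork_congruence_mul h0 hA hρ s
  set Q := seriesQuot (mk A) (frobSubst p (mk A))
  set T := seriesQuot (truncSeries (p ^ (s + 1)) (mk A))
    (frobSubst p (truncSeries (p ^ s) (mk A)))
  have hu : IsUnit (frobSubst p (mk A) * frobSubst p (truncSeries (p ^ s) (mk A))) := by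
    rw [isUnit_iff_constantCoeff, map_mul, hG, hS, one_mul]
    exact isUnit_one
  rw [← hu.dvd_mul_right]
  refine hdvd.trans (dvd_of_eq ?_)
  linear_combination h1 * frobSubst p (truncSeries (p ^ s) (mk A)) - h2 * frobSubst p (mk A)

end DworkCongruenceOfSequence

/-! ### The coefficients `(1/2)_n / n!` and their ratios -/

section HalfRatio

/-- `m` if `m` is prime to `p`, and `1` otherwise. -/
def primeToPart (p m : ℕ) : ℕ := if p ∣ m then 1 else m

/-- The product of those factors of `1 · 3 ⋯ (2n - 1)` that are prime to `p`. -/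
def oddProdPrimeTo (p n : ℕ) : ℕ := ∏ i ∈ Finset.range n, primeToPart p (2 * i + 1)

/-- The product of those factors of `2 · 4 ⋯ (2n)` that are prime to `p`. -/
def evenProdPrimeTo (p n : ℕ) : ℕ := ∏ i ∈ Finset.range n, primeToPart p (2 * i + 2)

/-- The last factor of `1 · 3 ⋯ (2n - 1)` divisible by `p` if it exceeds `2 p ⌊n / p⌋`. -/
def extraFactor (p n : ℕ) : ℕ := if p < 2 * (n % p) + 1 then p * (2 * (n / p) + 1) else 1

variable {p : ℕ}

theorem evenProd_eq [hp : Fact p.Prime] (h2 : p ≠ 2) (n : ℕ) :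
    ∏ i ∈ Finset.range n, (2 * i + 2) =
      evenProdPrimeTo p n * p ^ (n / p) * ∏ i ∈ Finset.range (n / p), (2 * i + 2) := by
  have hcop : p.Coprime 2 := (Nat.coprime_primes hp.out Nat.prime_two).2 h2
  induction n with
  | zero => simp [evenProdPrimeTo]
  | succ n ih =>
    have hdvd : p ∣ 2 * n + 2 ↔ p ∣ n + 1 := by
      rw [show 2 * n + 2 = 2 * (n + 1) by ring, hcop.dvd_mul_left]
    rw [Finset.prod_range_succ, ih, evenProdPrimeTo, evenProdPrimeTo, Finset.prod_range_succ,
      primeToPart]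
    by_cases h : p ∣ n + 1
    · rw [if_pos (hdvd.2 h), Nat.succ_div_of_dvd h, pow_succ, Finset.prod_range_succ]
      have : n + 1 = p * (n / p + 1) := by
        rw [← Nat.succ_div_of_dvd h, Nat.mul_div_cancel' h]
      rw [show 2 * n + 2 = 2 * (n + 1) by ring, this]
      ring
    · rw [if_neg (hdvd.not.2 h), Nat.succ_div_of_not_dvd h]
      ring

/-- The odd multiples of `p` are `p (2j + 1)`, each met halfway through a block of `p` factors;
hence one may occur beyond the `⌊n/p⌋` expected. -/
theorem oddProd_eq [hp : Fact p.Prime] (h2 : p ≠ 2) (n : ℕ) :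
    ∏ i ∈ Finset.range n, (2 * i + 1) =
      oddProdPrimeTo p n * p ^ (n / p) * (∏ i ∈ Finset.range (n / p), (2 * i + 1)) *
        extraFactor p n := by
  have hodd : p % 2 = 1 := (hp.out.eq_two_or_odd).resolve_left h2
  have hp0 := hp.out.pos
  induction n with
  | zero => simp [oddProdPrimeTo, extraFactor, hp0.ne']
  | succ n ih =>
    obtain ⟨b, c, hc, rfl⟩ : ∃ b c, c < p ∧ n = c + p * b :=
      ⟨n / p, n % p, Nat.mod_lt _ hp0, (Nat.mod_add_div n p).symm⟩
    have hdiv : (c + p * b) / p = b := by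
      rw [Nat.add_mul_div_left _ _ hp0, Nat.div_eq_of_lt hc, zero_add]
    have hmod : (c + p * b) % p = c := by
      rw [Nat.add_mul_mod_self_left, Nat.mod_eq_of_lt hc]
    have hdvd : p ∣ 2 * (c + p * b) + 1 ↔ 2 * c + 1 = p := by
      rw [show 2 * (c + p * b) + 1 = 2 * c + 1 + p * (2 * b) by ring,
        Nat.dvd_add_left (dvd_mul_right _ _)]
      constructor
      · rintro ⟨d, hd⟩
        have hd2 : d < 2 := by
          by_contra h
          have := Nat.mul_le_mul_left p (not_lt.1 h)
          omega
        interval_cases d <;> omega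
      · intro h
        rw [h]
    rw [Finset.prod_range_succ, ih, oddProdPrimeTo, oddProdPrimeTo, Finset.prod_range_succ,
      primeToPart, extraFactor, extraFactor, hdiv, hmod]
    rcases Nat.lt_or_ge (c + 1) p with hc1 | hc1
    · have hdiv' : (c + p * b + 1) / p = b := by
        rw [add_right_comm, Nat.add_mul_div_left _ _ hp0, Nat.div_eq_of_lt hc1, zero_add]
      have hmod' : (c + p * b + 1) % p = c + 1 := by
        rw [add_right_comm, Nat.add_mul_mod_self_left, Nat.mod_eq_of_lt hc1]
      rw [hdiv', hmod']
      by_cases h : 2 * c + 1 = p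
      · rw [if_pos (hdvd.2 h), if_neg (by omega), if_pos (by omega),
          show 2 * (c + p * b) + 1 = 2 * c + 1 + 2 * p * b by ring, h]
        ring
      · rw [if_neg (hdvd.not.2 h)]
        by_cases h' : p < 2 * c + 1
        · rw [if_pos h', if_pos (by omega)]
          ring
        · rw [if_neg h', if_neg (by omega)]
          ring
    -- The block is complete: the extra factor is absorbed into the two products indexed by `n / p`.
    · obtain rfl : p = c + 1 := by omega
      have hn : c + (c + 1) * b + 1 = (c + 1) * (b + 1) := by ring
      have hc0 : c ≠ 0 := by
        rintro rfl
        exact hp.out.ne_one rfl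
      rw [hn, Nat.mul_div_cancel_left _ hp0, Nat.mul_mod_right, if_neg (hdvd.not.2 (by omega)),
        if_pos (by omega), if_neg (by omega), Finset.prod_range_succ, pow_succ]
      ring

theorem prod_range_natCast_zmod {M : Type*} [CommMonoid M] (q : ℕ) [NeZero q] (g : ZMod q → M) :
    ∏ i ∈ Finset.range q, g i = ∏ z, g z := by
  refine Finset.prod_nbij' (fun i => (i : ZMod q)) ZMod.val ?_ ?_ ?_ ?_ ?_
  · simp
  · intro z _
    exact Finset.mem_range.2 z.val_lt
  · intro i hi
    exact ZMod.val_cast_of_lt (Finset.mem_range.1 hi)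
  · intro z _
    exact ZMod.natCast_zmod_val z
  · simp

theorem isUnit_natCast_zmod_pow_iff [hp : Fact p.Prime] (s m : ℕ) :
    IsUnit (m : ZMod (p ^ (s + 1))) ↔ ¬ p ∣ m := by
  rw [ZMod.isUnit_iff_coprime, Nat.coprime_pow_right_iff s.succ_pos, Nat.coprime_comm,
    hp.out.coprime_iff_not_dvd]

theorem isUnit_natCast_primeToPart [hp : Fact p.Prime] (s m : ℕ) :
    IsUnit (primeToPart p m : ZMod (p ^ (s + 1))) := by
  rw [isUnit_natCast_zmod_pow_iff, primeToPart]
  split_ifs with h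
  · exact hp.out.not_dvd_one
  · exact h

/-- The product of the prime-to-`p` parts along `p ^ (s + 1)` consecutive terms of an arithmetic
progression of step `2` is the product of all units modulo `p ^ (s + 1)`. -/
theorem prod_primeToPart_zmod [hp : Fact p.Prime] (h2 : p ≠ 2) (s n c : ℕ) :
    ∏ i ∈ Finset.range (p ^ (s + 1)),
        (primeToPart p (2 * (n + i) + c) : ZMod (p ^ (s + 1))) =
      ∏ z : ZMod (p ^ (s + 1)), if IsUnit z then z else 1 := by
  have hu : IsUnit (2 : ZMod (p ^ (s + 1))) := by
    have := (isUnit_natCast_zmod_pow_iff (p := p) s 2).2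
      fun h => h2 ((Nat.prime_dvd_prime_iff_eq hp.out Nat.prime_two).1 h)
    exact_mod_cast this
  have hbij : Function.Bijective fun z : ZMod (p ^ (s + 1)) => 2 * (n + z) + c := by
    refine Finite.injective_iff_bijective.1 fun x y h => ?_
    exact add_left_cancel (hu.mul_left_cancel (add_right_cancel h))
  rw [← hbij.prod_comp, ← prod_range_natCast_zmod]
  refine Finset.prod_congr rfl fun i _ => ?_
  have hcast : (2 * (n + i) + c : ZMod (p ^ (s + 1))) = ((2 * (n + i) + c : ℕ) : ZMod _) := by
    push_cast
    ring
  have hiff := isUnit_natCast_zmod_pow_iff (p := p) s (2 * (n + i) + c)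
  rw [hcast, primeToPart]
  by_cases h : p ∣ 2 * (n + i) + c
  · rw [if_pos h, if_neg (fun h' => hiff.1 h' h), Nat.cast_one]
  · rw [if_neg h, if_pos (hiff.2 h)]

theorem isUnit_natCast_padicInt [hp : Fact p.Prime] {m : ℕ} (h : ¬ p ∣ m) :
    IsUnit (m : ℤ_[p]) := by
  rw [PadicInt.isUnit_iff, PadicInt.norm_natCast_eq_one_iff]
  exact (hp.out.coprime_iff_not_dvd).2 h

theorem isUnit_evenProdPrimeTo [hp : Fact p.Prime] (n : ℕ) :
    IsUnit (evenProdPrimeTo p n : ℤ_[p]) := by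
  refine isUnit_natCast_padicInt ?_
  rw [evenProdPrimeTo, hp.out.prime.dvd_finsetProd_iff]
  rintro ⟨i, _, h⟩
  rw [primeToPart] at h
  split_ifs at h with h'
  · exact hp.out.not_dvd_one h
  · exact h' h

/-- The coefficients `(1/2)_n / n! = (2n choose n) / 4 ^ n`, as `p`-adic integers. -/
noncomputable def halfCoeff (p : ℕ) [Fact p.Prime] (n : ℕ) : ℤ_[p] :=
  (n.centralBinom : ℤ_[p]) * Ring.inverse 4 ^ n

/-- The ratio of the coefficients `(1/2)_n / n!` with indices `n` and `⌊n / p⌋`. -/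
noncomputable def halfRatio (p : ℕ) [Fact p.Prime] (n : ℕ) : ℤ_[p] :=
  (oddProdPrimeTo p n * extraFactor p n : ℕ) * Ring.inverse (evenProdPrimeTo p n : ℤ_[p])

theorem halfCoeff_succ_mul [hp : Fact p.Prime] (h2 : p ≠ 2) (n : ℕ) :
    halfCoeff p (n + 1) * (2 * n + 2) = halfCoeff p n * (2 * n + 1) := by
  have h4 : IsUnit (4 : ℤ_[p]) := by
    have : ¬ p ∣ 2 := fun h => h2 ((Nat.prime_dvd_prime_iff_eq hp.out Nat.prime_two).1 h)
    have h := (isUnit_natCast_padicInt this).pow 2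
    norm_num at h
    exact h
  have hc : ((n : ℤ_[p]) + 1) * (n + 1).centralBinom = 2 * (2 * n + 1) * n.centralBinom := by
    exact_mod_cast Nat.succ_mul_centralBinom_succ n
  have hi := Ring.mul_inverse_cancel _ h4
  rw [halfCoeff, halfCoeff, pow_succ]
  linear_combination 2 * Ring.inverse 4 ^ n * Ring.inverse 4 * hc +
    Ring.inverse 4 ^ n * n.centralBinom * (2 * n + 1) * hi

theorem halfCoeff_zero [Fact p.Prime] : halfCoeff p 0 = 1 := by
  simp [halfCoeff]

theorem halfCoeff_mul_evenProd [hp : Fact p.Prime] (h2 : p ≠ 2) (n : ℕ) :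
    halfCoeff p n * (∏ i ∈ Finset.range n, (2 * i + 2) : ℕ) =
      (∏ i ∈ Finset.range n, (2 * i + 1) : ℕ) := by
  induction n with
  | zero => simp [halfCoeff_zero]
  | succ n ih =>
    have h := halfCoeff_succ_mul h2 n
    rw [Finset.prod_range_succ, Finset.prod_range_succ, Nat.cast_mul, Nat.cast_mul, ← ih]
    push_cast
    linear_combination (∏ i ∈ Finset.range n, (2 * (i : ℤ_[p]) + 2)) * h

theorem halfCoeff_eq_mul_halfRatio [hp : Fact p.Prime] (h2 : p ≠ 2) (n : ℕ) :
    halfCoeff p n = halfCoeff p (n / p) * halfRatio p n := by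
  have hne : ((∏ i ∈ Finset.range n, (2 * i + 2) : ℕ) : ℤ_[p]) ≠ 0 :=
    Nat.cast_ne_zero.2 (Finset.prod_ne_zero_iff.2 fun i _ => Nat.succ_ne_zero _)
  refine mul_right_cancel₀ hne ?_
  rw [halfCoeff_mul_evenProd h2, oddProd_eq h2, evenProd_eq h2]
  have h := halfCoeff_mul_evenProd h2 (n / p)
  have hi := Ring.mul_inverse_cancel _ (isUnit_evenProdPrimeTo (p := p) n)
  rw [halfRatio, Nat.cast_mul, Nat.cast_mul _ (extraFactor p n), Nat.cast_mul, ← h,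
    Nat.cast_mul, Nat.cast_mul, Nat.cast_mul]
  linear_combination -(halfCoeff p (n / p) * oddProdPrimeTo p n * extraFactor p n *
    (p ^ (n / p) : ℕ) * (∏ i ∈ Finset.range (n / p), (2 * i + 2) : ℕ)) * hi

theorem natCast_extraFactor_add_mul_pow [hp : Fact p.Prime] (s n m : ℕ) :
    (extraFactor p (n + m * p ^ (s + 1)) : ZMod (p ^ (s + 1))) = extraFactor p n := by
  have hdiv : (n + m * p ^ (s + 1)) / p = n / p + m * p ^ s := by
    rw [pow_succ, ← mul_assoc, Nat.add_mul_div_right _ _ hp.out.pos]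
  have hmod : (n + m * p ^ (s + 1)) % p = n % p := by
    rw [pow_succ, ← mul_assoc, Nat.add_mul_mod_self_right]
  rw [extraFactor, extraFactor, hdiv, hmod]
  split_ifs
  · rw [show p * (2 * (n / p + m * p ^ s) + 1) =
      p * (2 * (n / p) + 1) + p ^ (s + 1) * (2 * m) by ring, Nat.cast_add, Nat.cast_mul (p ^ _),
      ZMod.natCast_self, zero_mul, add_zero]
  · rfl

theorem toZModPow_halfRatio_add_pow [hp : Fact p.Prime] (h2 : p ≠ 2) (s n : ℕ) :
    PadicInt.toZModPow (s + 1) (halfRatio p (n + p ^ (s + 1))) =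
      PadicInt.toZModPow (s + 1) (halfRatio p n) := by
  have key : ∀ n, PadicInt.toZModPow (s + 1) (halfRatio p n) *
      (evenProdPrimeTo p n : ZMod (p ^ (s + 1))) = oddProdPrimeTo p n * extraFactor p n := by
    intro n
    rw [← map_natCast (PadicInt.toZModPow (p := p) (s + 1)) (evenProdPrimeTo p n), ← map_mul,
      halfRatio, mul_assoc, Ring.inverse_mul_cancel _ (isUnit_evenProdPrimeTo n), mul_one,
      map_natCast, Nat.cast_mul]
  have hunit : ∀ (c n : ℕ), IsUnit ((∏ i ∈ Finset.range n, primeToPart p (2 * i + c) : ℕ) :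
      ZMod (p ^ (s + 1))) := by
    intro c n
    rw [Nat.cast_prod, IsUnit.prod_iff]
    exact fun i _ => isUnit_natCast_primeToPart s _
  have hshift : ∀ c, ((∏ i ∈ Finset.range (n + p ^ (s + 1)), primeToPart p (2 * i + c) : ℕ) :
      ZMod (p ^ (s + 1))) = (∏ i ∈ Finset.range n, primeToPart p (2 * i + c) : ℕ) *
        ∏ z : ZMod (p ^ (s + 1)), if IsUnit z then z else 1 := by
    intro c
    rw [Finset.prod_range_add, Nat.cast_mul, ← prod_primeToPart_zmod h2 s n c, Nat.cast_prod,
      Nat.cast_prod]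
  have h1 := key (n + p ^ (s + 1))
  have h3 := natCast_extraFactor_add_mul_pow (p := p) s n 1
  rw [one_mul] at h3
  have hu := hunit 2 (n + p ^ (s + 1))
  -- The even product is a unit, so the ratios may be compared after multiplying by it.
  refine hu.mul_right_cancel (h1.trans ?_)
  rw [h3, hshift, oddProdPrimeTo, hshift, ← mul_assoc]
  have h4 := key n
  rw [evenProdPrimeTo, oddProdPrimeTo] at h4
  rw [h4]
  ring

theorem toZModPow_halfRatio_add_mul_pow [hp : Fact p.Prime] (h2 : p ≠ 2) (s n m : ℕ) :
    PadicInt.toZModPow (s + 1) (halfRatio p (n + m * p ^ (s + 1))) =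
      PadicInt.toZModPow (s + 1) (halfRatio p n) := by
  induction m with
  | zero => simp
  | succ m ih => rw [Nat.succ_mul, ← add_assoc, toZModPow_halfRatio_add_pow h2, ih]

theorem dvd_halfRatio_pow_sub [hp : Fact p.Prime] (h2 : p ≠ 2) (r s n m : ℕ) :
    (p : ℤ_[p]) ^ (s + 1) ∣ halfRatio p (n + m * p ^ (s + 1)) ^ r - halfRatio p n ^ r := by
  rw [← Ideal.mem_span_singleton, ← PadicInt.ker_toZModPow, RingHom.mem_ker, map_sub, map_pow,
    map_pow, toZModPow_halfRatio_add_mul_pow h2, sub_self]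

theorem ascPochhammer_half_eval [hp : Fact p.Prime] (h2 : p ≠ 2) (n : ℕ) :
    (ascPochhammer ℚ_[p] n).eval (1 / 2) = (halfCoeff p n : ℚ_[p]) * n.factorial := by
  induction n with
  | zero => simp [halfCoeff_zero]
  | succ n ih =>
    have h : (halfCoeff p (n + 1) : ℚ_[p]) * (2 * n + 2) = halfCoeff p n * (2 * n + 1) := by
      exact_mod_cast congrArg ((↑) : ℤ_[p] → ℚ_[p]) (halfCoeff_succ_mul h2 n)
    rw [ascPochhammer_succ_eval, ih, Nat.factorial_succ, Nat.cast_mul, Nat.cast_succ]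
    linear_combination -(n.factorial : ℚ_[p]) / 2 * h

theorem map_mk_halfCoeff_pow [hp : Fact p.Prime] (h2 : p ≠ 2) (r : ℕ) :
    PowerSeries.map (PadicInt.Coe.ringHom (p := p)) (mk fun n => halfCoeff p n ^ (r + 1)) =
      hypergeometricSeries (fun _ : Fin (r + 1) => (1 / 2 : ℚ_[p]))
        (fun _ : Fin r => (1 : ℚ_[p])) := by
  ext n
  have hne : (n.factorial : ℚ_[p]) ≠ 0 := Nat.cast_ne_zero.2 n.factorial_ne_zero
  rw [hypergeometricSeries, coeff_map, coeff_mk, coeff_mk, map_pow]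
  simp only [Finset.prod_const, Finset.card_univ, Fintype.card_fin, ascPochhammer_half_eval h2,
    ascPochhammer_eval_one]
  rw [← pow_succ, ← div_pow, mul_div_cancel_right₀ _ hne]
  rfl

end HalfRatio

theorem mainTheorem5 (k : ℕ) (hk : 2 ≤ k) (p : ℕ) [Fact p.Prime] (hp : p ≠ 2) :
    ∃ F : ℤ_[p]⟦X⟧,
      PowerSeries.map (PadicInt.Coe.ringHom (p := p)) F =
        hypergeometricSeries (fun _ : Fin (k - 1) => (1 / 2 : ℚ_[p]))
          (fun _ : Fin (k - 2) => (1 : ℚ_[p])) ∧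
      PowerSeries.constantCoeff F = 1 ∧
      ∀ s : ℕ, 1 ≤ s → DworkCongruence p F s := by
  obtain ⟨r, rfl⟩ := Nat.exists_eq_add_of_le' hk
  have h0 : halfCoeff p 0 ^ (r + 1) = 1 := by rw [halfCoeff_zero, one_pow]
  refine ⟨mk fun n => halfCoeff p n ^ (r + 1), map_mk_halfCoeff_pow hp r, ?_, fun s hs => ?_⟩
  · rw [← coeff_zero_eq_constantCoeff_apply, coeff_mk, h0]
  · refine dworkCongruence_mk (ρ := fun n => halfRatio p n ^ (r + 1)) h0 (fun n => ?_)
      (dvd_halfRatio_pow_sub hp (r + 1)) hs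
    rw [← mul_pow, ← halfCoeff_eq_mul_halfRatio hp]
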